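/- Let $\mathcal G$ be a Grothendieck category and let $\mathcal I\subseteq\mathrm{Inj}(\mathcal G)$ be an injective class consisting of injective objects. That is, $\mathcal I$ is closed under products and direct summands, and every object $A$ of $\mathcal G$ admits a morphism $\phi\colon A\to I$ with $I\in\mathcal I$ which is an $\mathcal I$-monomorphism (meaning that $\mathrm{Hom}(\phi,J)$ is surjective for every $J\in\mathcal I$). Let $\mathcal T={}^\perp\mathcal I=\{X : \mathrm{Hom}(X,J)=0 \text{ for all } J\in\mathcal I\}$ and $\mathcal F=\mathcal T^\perp$, so that $(\mathcal T,\mathcal F)$ is the hereditary torsion pair associated with $\mathcal I$, and let $\mathcal G/\mathcal T$ be the Gabriel quotient, i.e. the localization of $\mathcal G$ at the morphisms whose kernel and cokernel belong to $\mathcal T$. Let $k\ge 0$ be an integer. Then the following are equivalent: (1) $\mathcal G$ is (Ab.4$^*$)-$\mathcal I$-$k$: for every (small) family $(A_\lambda)_{\lambda\in\Lambda}$ of objects of $\mathcal G$ and every choice of relative $\mathcal I$-injective resolutions $u_\lambda\colon A_\lambda\to I_\lambda^\bullet$, one has $$H^{-n}\Bigl(\mathrm{Hom}\bigl(\textstyle\prod_{\lambda}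 I_\lambda^\bullet, J\bigr)\Bigr)=0\qquad\text{for all } J\in\mathcal I \text{ and all } n>k.$$ Here a relative $\mathcal I$-injective resolution of $A$ is a complex $I^\bullet$ of objects of $\mathcal I$ concentrated in degrees $\ge 0$ together with a morphism of complexes $u\colon A\to I^\bullet$ ($A$ placed in degree $0$) such that $\mathrm{Hom}(u,J)\colon\mathrm{Hom}(I^\bullet,J)\to\mathrm{Hom}(A,J)$ is a quasi-isomorphism of complexes of abelian groups for every $J\in\mathcal I$. (2) $\mathcal G/\mathcal T$ is (Ab.4$^*$)-$k$ in the sense of Roos: it is a complete abelian category with enough injectives and, for every (small) family $(B_\lambda)_{\lambda\in\Lambda}$ of its objects, the $n$-th right derived functor of the product $\prod^{(n)}_{\lambda}B_\lambda$ vanishes for all $n>k$. -/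

import Mathlib

open CategoryTheory Limits Opposite

universe w v u

namespace RelInj

section Relative

variable {A : Type u} [Category.{v} A] [Abelian A]

/-- `φ : X ⟶ Y` is an `I`-monomorphism if `Hom(φ, J) : Hom(Y, J) → Hom(X, J)` is surjective
for all `J` in the class `I`. -/
def IsRelMono (I : ObjectProperty A) {X Y : A} (φ : X ⟶ Y) : Prop :=
  ∀ ⦃J : A⦄, I J → Function.Surjective (fun g : Y ⟶ J => φ ≫ g)

/-- Injective classes of objects: closed under (`w`-small) products and under summands, and
every object admits an `I`-monomorphism into an object of `I`. -/
structure IsInjectiveClass (I : ObjectProperty A) : Prop where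
  closedUnderProducts : ∀ Λ : Type w, I.IsClosedUnderLimitsOfShape (Discrete Λ)
  closedUnderSummands : I.IsStableUnderRetracts
  exists_relMono : ∀ X : A, ∃ (J : A) (φ : X ⟶ J), I J ∧ IsRelMono I φ

/-- The complex of abelian groups `Hom(X^•, J)`. A cochain complex in nonnegative degrees is
indexed by `ℕ`; then `Hom(X^•, J)` sits in nonpositive cohomological degrees, and is written as
a chain complex indexed by `ℕ`: its `n`-th homology is `H^{-n}(Hom(X^•, J))`. -/
noncomputable def homComplex (X : CochainComplex A ℕ) (J : A) :
    HomologicalComplex AddCommGrpCat.{v} (ComplexShape.up ℕ).symm :=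
  ((preadditiveYoneda.obj J).mapHomologicalComplex _).obj X.op

/-- The morphism `Hom(φ, J) : Hom(Y^•, J) ⟶ Hom(X^•, J)` of complexes of abelian groups
induced by a morphism of complexes `φ : X^• ⟶ Y^•`. -/
noncomputable def homComplexMap {X Y : CochainComplex A ℕ} (φ : X ⟶ Y) (J : A) :
    homComplex Y J ⟶ homComplex X J :=
  ((preadditiveYoneda.obj J).mapHomologicalComplex _).map
    ((HomologicalComplex.opFunctor A (ComplexShape.up ℕ)).map φ.op)

/-- A relative `I`-injective resolution of `X`: a complex of objects of `I` in nonnegative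
degrees, with a morphism `u` from `X` (seen as a complex in degree `0`) such that `Hom(u, J)`
is a quasi-isomorphism for all `J` in `I`. -/
structure RelInjResolution (I : ObjectProperty A) (X : A) where
  /-- the underlying complex -/
  cocomplex : CochainComplex A ℕ
  /-- the coaugmentation -/
  u : (CochainComplex.single₀ A).obj X ⟶ cocomplex
  mem : ∀ n, I (cocomplex.X n)
  quasiIso : ∀ ⦃J : A⦄, I J → QuasiIso (homComplexMap u J)

/-- The condition (Ab.4*)-`I`-`k`: for each (`w`-small) family of objects and each choice of
relative `I`-injective resolutions of its members, the product `P^•` of the resolutions satisfies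
`H^{-n}(Hom(P^•, J)) = 0` for all `J` in `I` and all `n > k`. -/
def RelAB4Star [HasLimitsOfSize.{w, w} A] (I : ObjectProperty A) (k : ℕ) : Prop :=
  ∀ (Λ : Type w) (X : Λ → A) (R : ∀ l, RelInjResolution I (X l)) (J : A), I J →
    ∀ n : ℕ, k < n →
      IsZero ((homComplex (∏ᶜ fun l => (R l).cocomplex) J).homology n)

/-- The torsion class `⊥I` of objects `X` with `Hom(X, J) = 0` for all `J` in `I`. -/
abbrev torsionClass (I : ObjectProperty A) : ObjectProperty A := I.leftOrthogonal

/-- If `I` consists of injective objects, then `⊥I` is closed under subobjects, quotients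
and extensions. -/
theorem isSerreClass_torsionClass {I : ObjectProperty A} (hI : I ≤ isInjective A) :
    (torsionClass I).IsSerreClass where
  exists_zero := ObjectProperty.ContainsZero.exists_zero
  prop_of_mono {X Y} f _ hY J g hJ := by
    have : Injective J := hI J hJ
    rw [← Injective.comp_factorThru g f, hY (Injective.factorThru g f) hJ, comp_zero]
  prop_of_epi {X Y} f _ hX J g hJ := by
    rw [← cancel_epi f, hX (f ≫ g) hJ, comp_zero]
  prop_X₂_of_shortExact {S} hS h₁ h₃ J g hJ := by
    have := hS.epi_g
    rw [← hS.exact.g_desc g (h₁ _ hJ), h₃ (hS.exact.desc g (h₁ _ hJ)) hJ, comp_zero]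

/-- The Gabriel quotient `A/T`: the localization of `A` at the morphisms whose kernel and
cokernel lie in `T`. -/
def GabrielQuotient (T : ObjectProperty A) [T.IsSerreClass] : Type u :=
  T.isoModSerre.Localization

instance (T : ObjectProperty A) [T.IsSerreClass] : Category (GabrielQuotient T) :=
  inferInstanceAs (Category T.isoModSerre.Localization)

/-- The quotient functor `A ⥤ A/T`. -/
def quotientFunctor (T : ObjectProperty A) [T.IsSerreClass] : A ⥤ GabrielQuotient T :=
  T.isoModSerre.Q

instance (T : ObjectProperty A) [T.IsSerreClass] :
    (quotientFunctor T).IsLocalization T.isoModSerre :=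
  inferInstanceAs (T.isoModSerre.Q.IsLocalization T.isoModSerre)

noncomputable instance (T : ObjectProperty A) [T.IsSerreClass] :
    Preadditive (GabrielQuotient T) :=
  inferInstanceAs (Preadditive T.isoModSerre.Localization)

instance (T : ObjectProperty A) [T.IsSerreClass] : (quotientFunctor T).Additive :=
  inferInstanceAs T.isoModSerre.Q.Additive

noncomputable instance (T : ObjectProperty A) [T.IsSerreClass] : Abelian (GabrielQuotient T) :=
  ObjectProperty.SerreClassLocalization.abelian (quotientFunctor T) T

end Relative

section Roos

variable {A : Type u} [Category.{v} A] [Abelian A]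

/-- A category of families of objects of `A` has enough injectives if `A` does: take
injective objects componentwise. -/
instance enoughInjectives_families [EnoughInjectives A] (Λ : Type w) :
    EnoughInjectives (Discrete Λ ⥤ A) where
  presentation X := by
    let J : Discrete Λ ⥤ A := Discrete.functor fun l => Injective.under (X.obj ⟨l⟩)
    let ι : X ⟶ J := Discrete.natTrans fun l => Injective.ι (X.obj ⟨l.as⟩)
    have hι : ∀ l, Mono (ι.app l) := fun l => Injective.ι_mono (X.obj ⟨l.as⟩)
    have hJ : ∀ l, Injective (J.obj l) := fun l => Injective.injective_under (X.obj ⟨l.as⟩)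
    refine ⟨⟨J, ?_, ι, NatTrans.mono_of_mono_app ι⟩⟩
    refine ⟨fun {P Q} g f _ => ⟨Discrete.natTrans fun l =>
      Injective.factorThru (g.app l) (f.app l), ?_⟩⟩
    ext l
    exact Injective.comp_factorThru _ _

instance additive_lim (Λ : Type w) [HasLimitsOfShape (Discrete Λ) A] :
    (lim : (Discrete Λ ⥤ A) ⥤ A).Additive :=
  Functor.additive_of_preserves_binary_products _

/-- The `n`-th right derived functor `∏^{(n)}` of the product functor on `Λ`-indexed families,
evaluated at the family `X`. -/
noncomputable def derivedProduct [EnoughInjectives A] {Λ : Type w}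
    [HasLimitsOfShape (Discrete Λ) A] (n : ℕ) (X : Λ → A) : A :=
  ((lim : (Discrete Λ ⥤ A) ⥤ A).rightDerived n).obj (Discrete.functor X)

variable (A) in
/-- The condition (Ab.4*)-`k` of Roos on an abelian category: it is complete with enough
injectives, and the derived products `∏^{(n)}` of (`w`-small) families vanish for `n > k`. -/
structure RoosAB4Star (k : ℕ) : Prop where
  complete : HasLimitsOfSize.{w, w} A
  enoughInjectives : EnoughInjectives A
  isZero_derivedProduct : ∀ (Λ : Type w) (X : Λ → A) (n : ℕ), k < n →
    IsZero (derivedProduct n X)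

end Roos

end RelInj

/-! Let `L` be the quotient functor, with torsion class `T = ⊥I`. Objects of `I` are injective, so
`L` inverts exactly the morphisms inverted by every `Hom(-, J)`, `J` in `I`; in particular objects
of `I` are local. As `Hom(-, J)` is exact, `H^{-n}(Hom(P, J)) = Hom(H^n(P), J)`, which vanishes for
all `J` in `I` iff `H^n(P)` is torsion, iff `L` kills it
(`isZero_homComplex_homology_iff_torsionClass`).

The exact functor `L` has a right adjoint `R`; `L` sends `I` to injectives and `R` sends injectives
into `I`. Hence `L` turns relative resolutions into injective resolutions, and each injective
resolution in the quotient arises so, up to isomorphism. Finally `L` preserves products of local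
objects, so `L(H^n(∏ K_l))` is the derived product of the objects resolved by the `L(K_l)`. Both
conditions thus say that `H^n(∏ K_l)` is torsion (`isZero_derivedProduct_iff`). -/

namespace RelInj

/-! ### Torsion and local objects -/

section LocalObjects

variable {A : Type u} [Category.{v} A] [Abelian A] {I : ObjectProperty A}

lemma torsionClass_kernel_of_isRelMono (hInj : I ≤ isInjective A) {X Y : A} {φ : X ⟶ Y}
    (hφ : IsRelMono I φ) : torsionClass I (kernel φ) := by
  intro J h hJ
  have : Injective J := hInj J hJ
  obtain ⟨m, hm : φ ≫ m = _⟩ := hφ hJ (Injective.factorThru h (kernel.ι φ))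
  rw [← Injective.comp_factorThru h (kernel.ι φ), ← hm, kernel.condition_assoc, zero_comp]

/-- The morphisms with torsion kernel and cokernel are those inverted by `Hom(-, J)` for
all `J` in `I`. -/
lemma isoModSerre_torsionClass (hInj : I ≤ isInjective A) [(torsionClass I).IsSerreClass] :
    (torsionClass I).isoModSerre = I.isLocal := by
  ext X Y f
  refine ⟨fun ⟨hk, hc⟩ J hJ ↦ ?_, fun hf ↦ ⟨fun J h hJ ↦ ?_, fun J h hJ ↦ ?_⟩⟩
  · have : Injective J := hInj J hJ
    refine ⟨fun g₁ g₂ h ↦ ?_, fun g ↦ ?_⟩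
    · have h' : f ≫ (g₁ - g₂) = 0 := by rw [Preadditive.comp_sub, sub_eq_zero]; exact h
      rw [← sub_eq_zero, ← cokernel.π_desc f _ h', hc (cokernel.desc f _ h') hJ, comp_zero]
    · exact ⟨(ShortComplex.exact_kernel f).descToInjective g (hk _ hJ),
        (ShortComplex.exact_kernel f).comp_descToInjective g (hk _ hJ)⟩
  · have : Injective J := hInj J hJ
    obtain ⟨m, hm : f ≫ m = _⟩ := (hf J hJ).2 (Injective.factorThru h (kernel.ι f))
    rw [← Injective.comp_factorThru h (kernel.ι f), ← hm, kernel.condition_assoc, zero_comp]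
  · rw [← cancel_epi (cokernel.π f), comp_zero]
    exact (hf J hJ).1 (by simp)

lemma isLocal_isoModSerre_of_mem (hInj : I ≤ isInjective A) [(torsionClass I).IsSerreClass]
    {J : A} (hJ : I J) : (torsionClass I).isoModSerre.isLocal J := by
  rw [isoModSerre_torsionClass hInj]
  exact I.le_isLocal_isLocal J hJ

lemma isLocal_kernel {W : MorphismProperty A} {X Y : A} (f : X ⟶ Y)
    (hX : W.isLocal X) (hY : W.isLocal Y) : W.isLocal (kernel f) := by
  intro B C s hs
  refine ⟨fun g₁ g₂ h ↦ ?_, fun g ↦ ?_⟩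
  · rw [← cancel_mono (kernel.ι f)]
    exact (hX s hs).1 (by simpa using! h =≫ kernel.ι f)
  · obtain ⟨h, hh : s ≫ h = _⟩ := (hX s hs).2 (g ≫ kernel.ι f)
    have hf : h ≫ f = 0 := (hY s hs).1 (by simp [reassoc_of% hh])
    exact ⟨kernel.lift f h hf, by simp [← cancel_mono (kernel.ι f), hh]⟩

/-- Each object has a reflection in the local objects. -/
lemma exists_isoModSerre_isLocal (hI : IsInjectiveClass.{w} I) (hInj : I ≤ isInjective A)
    [(torsionClass I).IsSerreClass] (X : A) :
    ∃ (Y : A) (f : X ⟶ Y), (torsionClass I).isoModSerre f ∧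
      (torsionClass I).isoModSerre.isLocal Y := by
  -- The reflection is the kernel of `J₀ ⟶ J₁`, where `X ⟶ J₀ ⟶ J₁` begins a relative resolution.
  obtain ⟨J₀, φ, hJ₀, hφ⟩ := hI.exists_relMono X
  obtain ⟨J₁, ψ, hJ₁, hψ⟩ := hI.exists_relMono (cokernel φ)
  refine ⟨kernel (cokernel.π φ ≫ ψ), kernel.lift _ φ (by simp), ?_,
    isLocal_kernel _ (isLocal_isoModSerre_of_mem hInj hJ₀)
      (isLocal_isoModSerre_of_mem hInj hJ₁)⟩
  rw [isoModSerre_torsionClass hInj]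
  intro J hJ
  have : Injective J := hInj J hJ
  refine ⟨fun g₁ g₂ h ↦ ?_, fun g ↦ ?_⟩
  -- Extend `g` to `e` on `J₀`; since `e` kills `φ`, it factors through `J₀ ⟶ J₁`, so it vanishes on
  -- the kernel.
  · let g := g₁ - g₂
    have hg : kernel.lift (cokernel.π φ ≫ ψ) φ (by simp) ≫ g = 0 := by
      rw [Preadditive.comp_sub, sub_eq_zero]; exact h
    let e : J₀ ⟶ J := Injective.factorThru g (kernel.ι _)
    have he : kernel.ι _ ≫ e = g := Injective.comp_factorThru g (kernel.ι _)
    have hφe : φ ≫ e = 0 := by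
      rw [← kernel.lift_ι (cokernel.π φ ≫ ψ) φ (by simp), Category.assoc, he, hg]
    obtain ⟨m, hm : ψ ≫ m = _⟩ := hψ hJ (cokernel.desc φ e hφe)
    have hem : e = (cokernel.π φ ≫ ψ) ≫ m := by simp [hm]
    rw [← sub_eq_zero]
    change g = 0
    rw [← he, hem, kernel.condition_assoc, zero_comp]
  · obtain ⟨m, hm : φ ≫ m = _⟩ := hφ hJ g
    exact ⟨kernel.ι _ ≫ m, by simpa using hm⟩

end LocalObjects

/-! ### Local objects and the right adjoint of a localization -/

section Localization

universe v' u'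

variable {A : Type u} [Category.{v} A] {D : Type u'} [Category.{v'} D] (L : A ⥤ D)

/-- In a right fraction `X ← X' ⟶ Z` the denominator is inverted by `Hom(-, Z)`, so the fraction is
an actual morphism. -/
lemma bijective_map_of_isLocal (W : MorphismProperty A) [L.IsLocalization W]
    [W.HasRightCalculusOfFractions] {X Z : A} (hZ : W.isLocal Z) :
    Function.Bijective (fun f : X ⟶ Z ↦ L.map f) := by
  refine ⟨fun f g h ↦ ?_, fun f ↦ ?_⟩
  · obtain ⟨X', s, hs, eq⟩ := (MorphismProperty.map_eq_iff_precomp L W f g).1 h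
    exact (hZ s hs).1 eq
  · obtain ⟨φ, hφ⟩ := Localization.exists_rightFraction L W f
    obtain ⟨g, hg : φ.s ≫ g = _⟩ := (hZ φ.s φ.hs).2 φ.f
    have := Localization.inverts L W φ.s φ.hs
    refine ⟨g, ?_⟩
    rw [hφ, ← cancel_epi (L.map φ.s)]
    simp [← L.map_comp, hg]

lemma isLeftAdjoint_of_exists_isLocal (W : MorphismProperty A) [L.IsLocalization W]
    [W.HasRightCalculusOfFractions]
    (hW : ∀ X : A, ∃ (Y : A) (f : X ⟶ Y), W f ∧ W.isLocal Y) : L.IsLeftAdjoint := by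
  have := Localization.essSurj L W
  have h (Y : D) : ∃ (Z : A), W.isLocal Z ∧ Nonempty (L.obj Z ≅ Y) := by
    obtain ⟨Z, f, hf, hZ⟩ := hW (L.objPreimage Y)
    have := Localization.inverts L W f hf
    exact ⟨Z, hZ, ⟨(asIso (L.map f)).symm ≪≫ L.objObjPreimageIso Y⟩⟩
  choose R hR e using h
  let e' (X : A) (Y : D) : (L.obj X ⟶ Y) ≃ (X ⟶ R Y) :=
    ((e Y).some.homToEquiv.symm).trans
      (Equiv.ofBijective _ (bijective_map_of_isLocal L W (X := X) (hR Y))).symm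
  have he' (X : A) (Y : D) (g : L.obj X ⟶ Y) : L.map (e' X Y g) = g ≫ (e Y).some.inv :=
    (Equiv.ofBijective _ (bijective_map_of_isLocal L W (X := X) (hR Y))).apply_symm_apply _
  exact ⟨_, ⟨Adjunction.adjunctionOfEquivRight e' fun X' X Y f g ↦
    (bijective_map_of_isLocal L W (hR Y)).1 (by simp [he'])⟩⟩

lemma isLocal_obj_of_adj {L} (W : MorphismProperty A) (hW : W.IsInvertedBy L)
    {R : D ⥤ A} (adj : L ⊣ R) (Y : D) : W.isLocal (R.obj Y) := by
  intro X X' f hf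
  have := hW f hf
  rw [← Function.Bijective.of_comp_iff _ (adj.homEquiv X' Y).bijective,
    ← Function.Bijective.of_comp_iff' (adj.homEquiv X Y).symm.bijective]
  have : (adj.homEquiv X Y).symm ∘ (fun g ↦ f ≫ g) ∘ adj.homEquiv X' Y =
      fun g ↦ L.map f ≫ g := by
    ext g
    simp [Adjunction.homEquiv_naturality_left_symm]
  rw [this]
  exact (asIso (L.map f)).homFromEquiv.symm.bijective

lemma isIso_counit_app_of_isLocalization {L : A ⥤ D} (W : MorphismProperty A)
    [L.IsLocalization W] [W.HasRightCalculusOfFractions] {R : D ⥤ A} (adj : L ⊣ R) (Y : D) :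
    IsIso (adj.counit.app Y) := by
  have := Localization.essSurj L W
  let e := L.objObjPreimageIso Y
  let r : Y ⟶ L.obj (R.obj Y) := e.inv ≫ L.map (adj.homEquiv _ _ e.hom)
  have hr : r ≫ adj.counit.app Y = 𝟙 _ := by
    simp [r, ← Adjunction.homEquiv_counit]
  refine ⟨r, ?_, hr⟩
  -- `r` is a section of the counit; the other composite lifts to some `t`, which is the identity by
  -- adjunction.
  obtain ⟨t, ht⟩ := (bijective_map_of_isLocal L W (X := R.obj Y) (Z := R.obj Y)
    (isLocal_obj_of_adj W (Localization.inverts L W) adj Y)).2 (adj.counit.app Y ≫ r)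
  dsimp only at ht
  rw [← ht, show t = 𝟙 _ from ?_, L.map_id]
  · rfl
  · apply (adj.homEquiv _ _).symm.injective
    simp [Adjunction.homEquiv_counit, ht, hr]

end Localization

/-! ### Injectives in the quotient -/

section Quotient

universe v' u'

variable {A : Type u} [Category.{v} A] [Abelian A] {I : ObjectProperty A}
  {D : Type u'} [Category.{v'} D] [Abelian D] {L : A ⥤ D} [L.Additive]
  [(torsionClass I).IsSerreClass] [L.IsLocalization (torsionClass I).isoModSerre]
  {R : D ⥤ A}

/-- An `I`-monomorphism out of `R E` has torsion kernel, which has no nonzero map to `R E` by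
adjunction. It is therefore mono, and splits because `R E` is injective. -/
lemma mem_of_injective_of_adj (hI : IsInjectiveClass.{w} I) (hInj : I ≤ isInjective A)
    (adj : L ⊣ R) (E : D) [Injective E] : I (R.obj E) := by
  have := ObjectProperty.SerreClassLocalization.preservesMonomorphisms L (torsionClass I)
  have : Injective (R.obj E) := adj.map_injective E inferInstance
  obtain ⟨J, φ, hJ, hφ⟩ := hI.exists_relMono (R.obj E)
  have : Mono φ := by
    apply Preadditive.mono_of_kernel_zero
    apply (adj.homEquiv _ _).symm.injective
    exact ((ObjectProperty.SerreClassLocalization.isZero_obj_iff L (torsionClass I) _).2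
      (torsionClass_kernel_of_isRelMono hInj hφ)).eq_of_src _ _
  have := hI.closedUnderSummands
  exact I.prop_of_retract
    { i := φ, r := Injective.factorThru (𝟙 _) φ } hJ

/-- Monomorphisms in `D` come from monomorphisms in `A`, and morphisms into `L J` lift to `A`
because `J` is local. -/
lemma injective_obj_of_mem (hInj : I ≤ isInjective A) {J : A} (hJ : I J) :
    Injective (L.obj J) where
  factors {X Y} g f _ := by
    obtain ⟨X', Y', f', _, ⟨e⟩⟩ :=
      (ObjectProperty.SerreClassLocalization.mono_iff L (torsionClass I) f).1 inferInstance
    have : Injective J := hInj J hJ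
    obtain ⟨g', hg'⟩ := (bijective_map_of_isLocal L (torsionClass I).isoModSerre
      (isLocal_isoModSerre_of_mem hInj hJ)).2 (e.hom.left ≫ g)
    dsimp only at hg'
    refine ⟨e.inv.right ≫ L.map (Injective.factorThru g' f'), ?_⟩
    have := e.inv.w
    dsimp at this
    rw [← reassoc_of% this, ← L.map_comp, Injective.comp_factorThru, hg',
      Arrow.inv_hom_id_left_assoc]

variable (I) in
lemma enoughInjectives_of_adj (hI : IsInjectiveClass.{w} I) (hInj : I ≤ isInjective A)
    (adj : L ⊣ R) : EnoughInjectives D where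
  presentation Y := by
    have := isIso_counit_app_of_isLocalization (torsionClass I).isoModSerre adj Y
    obtain ⟨J, φ, hJ, hφ⟩ := hI.exists_relMono (R.obj Y)
    have : Mono (L.map φ) :=
      (ObjectProperty.SerreClassLocalization.mono_map_iff L (torsionClass I) φ).2
        (torsionClass_kernel_of_isRelMono hInj hφ)
    exact ⟨{ J := L.obj J
             injective := injective_obj_of_mem hInj hJ
             f := inv (adj.counit.app Y) ≫ L.map φ }⟩

end Quotient

/-! ### Limits in the quotient -/

section

universe w' v' u'

lemma hasLimitsOfSize_of_isLocalization {A : Type u} [Category.{v} A] {D : Type u'}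
    [Category.{v'} D] {L : A ⥤ D} (W : MorphismProperty A) [L.IsLocalization W]
    [W.HasRightCalculusOfFractions] {R : D ⥤ A} (adj : L ⊣ R) [HasLimitsOfSize.{w, w'} A] :
    HasLimitsOfSize.{w, w'} D := by
  have (Y : D) := isIso_counit_app_of_isLocalization W adj Y
  have : IsIso adj.counit := NatIso.isIso_of_isIso_app _
  have h := adj.fullyFaithfulROfIsIsoCounit
  have := h.full
  have := h.faithful
  let : Reflective R := { L := L, adj := adj }
  exact hasLimits_of_reflective R

/-- A localization functor preserves products of local objects. -/
lemma nonempty_isLimit_map_fan {A : Type u} [Category.{v} A] {D : Type u'}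
    [Category.{v'} D] (L : A ⥤ D) (W : MorphismProperty A) [L.IsLocalization W]
    [W.HasRightCalculusOfFractions] {Λ : Type w} {Y : Λ → A} (hY : ∀ l, W.isLocal (Y l))
    {c : Fan Y} (hc : IsLimit c) :
    Nonempty (IsLimit (Fan.mk (L.obj c.pt) fun l ↦ L.map (c.proj l))) := by
  have := Localization.essSurj L W
  have hpt : W.isLocal c.pt := W.isLocal.prop_of_isLimit hc fun ⟨l⟩ ↦ hY l
  have key (s : Fan fun l ↦ L.obj (Y l)) : ∃! m : s.pt ⟶ L.obj c.pt,
      ∀ l, m ≫ L.map (c.proj l) = s.proj l := by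
    let e := L.objObjPreimageIso s.pt
    choose t ht using fun l ↦ (bijective_map_of_isLocal L W (hY l)).2 (e.hom ≫ s.proj l)
    dsimp only at ht
    refine ⟨e.inv ≫ L.map (Fan.IsLimit.lift hc t), fun l ↦ ?_, fun m hm ↦ ?_⟩
    · simp [← L.map_comp, ht, Fan.IsLimit.fac]
    · obtain ⟨m', hm'⟩ := (bijective_map_of_isLocal L W hpt).2 (e.hom ≫ m)
      dsimp only at hm'
      rw [← cancel_epi e.hom, ← hm', Iso.hom_inv_id_assoc]
      congr 1
      refine Fan.IsLimit.hom_ext hc _ _ fun l ↦ (bijective_map_of_isLocal L W (hY l)).1 ?_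
      simp [hm', ht, hm, Fan.IsLimit.fac]
  choose m hm hm' using key
  exact ⟨Fan.IsLimit.mk _ m hm fun s m' h ↦ hm' s m' h⟩

end

/-! ### Exact functors and homology -/

section Homology

universe v' u'

variable {C : Type u} [Category.{v} C] [Abelian C] {D : Type u'} [Category.{v'} D] [Abelian D]
  (F : C ⥤ D) [F.Additive] [F.PreservesHomology] {ι : Type*} {c : ComplexShape ι}

/-- Exact functors commute with homology. -/
noncomputable def homologyMapIso (K : HomologicalComplex C c) (n : ι) :
    ((F.mapHomologicalComplex c).obj K).homology n ≅ F.obj (K.homology n) :=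
  (K.sc n).mapHomologyIso F

lemma quasiIso_map_iff {K K' : HomologicalComplex C c} (φ : K ⟶ K') :
    QuasiIso ((F.mapHomologicalComplex c).map φ) ↔
      ∀ n, IsIso (F.map (HomologicalComplex.homologyMap φ n)) := by
  rw [quasiIso_iff]
  refine forall_congr' fun n ↦ ?_
  rw [quasiIsoAt_iff_isIso_homologyMap]
  have h : HomologicalComplex.homologyMap ((F.mapHomologicalComplex c).map φ) n ≫
      (homologyMapIso F K' n).hom =
      (homologyMapIso F K n).hom ≫ F.map (HomologicalComplex.homologyMap φ n) :=
    ShortComplex.mapHomologyIso_hom_naturality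
      ((HomologicalComplex.shortComplexFunctor C c n).map φ) F
  rw [← isIso_comp_right_iff _ (homologyMapIso F K' n).hom, h, isIso_comp_left_iff]

end Homology

/-! ### Homology of `Hom` complexes -/

section HomComplex

variable {A : Type u} [Category.{v} A] [Abelian A]

instance preservesHomology_preadditiveYoneda_obj (J : A) [Injective J] :
    (preadditiveYoneda.obj J).PreservesHomology := by
  have := (Injective.injective_iff_preservesEpimorphisms_preadditiveYoneda_obj J).1 inferInstance
  apply Functor.preservesHomology_of_preservesEpis_and_kernels

/-- If `J` is injective, then `H^{-n}(Hom(X^•, J)) ≅ Hom(H^n(X^•), J)`. -/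
noncomputable def homComplexHomologyIso (X : CochainComplex A ℕ) (J : A) [Injective J] (n : ℕ) :
    (homComplex X J).homology n ≅ (preadditiveYoneda.obj J).obj (op (X.homology n)) :=
  homologyMapIso (preadditiveYoneda.obj J) X.op n ≪≫
    (preadditiveYoneda.obj J).mapIso (X.homologyOp n)

lemma isZero_homComplex_homology_iff (X : CochainComplex A ℕ) (J : A) [Injective J] (n : ℕ) :
    IsZero ((homComplex X J).homology n) ↔ ∀ f : X.homology n ⟶ J, f = 0 := by
  rw [(homComplexHomologyIso X J n).isZero_iff, AddCommGrpCat.isZero_iff_subsingleton]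
  exact ⟨fun h f ↦ h.elim _ _, fun h ↦ ⟨fun f g ↦ (h f).trans (h g).symm⟩⟩

lemma quasiIso_homComplexMap_iff {X Y : CochainComplex A ℕ} (φ : X ⟶ Y) (J : A) [Injective J] :
    QuasiIso (homComplexMap φ J) ↔
      ∀ n, Function.Bijective fun g : Y.homology n ⟶ J ↦
        HomologicalComplex.homologyMap φ n ≫ g := by
  refine (quasiIso_map_iff (preadditiveYoneda.obj J)
    ((HomologicalComplex.opFunctor A (ComplexShape.up ℕ)).map φ.op)).trans
    (forall_congr' fun n ↦ ?_)
  refine ((MorphismProperty.isomorphisms _).arrow_mk_iso_iff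
    ((preadditiveYoneda.obj J).mapArrow.mapIso (Arrow.isoMk' _ _ (Y.homologyOp n) (X.homologyOp n)
      (HomologicalComplex.homologyOp_hom_naturality φ n).symm))).trans ?_
  exact ConcreteCategory.isIso_iff_bijective (C := AddCommGrpCat) _

variable {I : ObjectProperty A}

lemma isZero_homComplex_homology_iff_torsionClass (hInj : I ≤ isInjective A)
    (X : CochainComplex A ℕ) (n : ℕ) :
    (∀ J, I J → IsZero ((homComplex X J).homology n)) ↔ torsionClass I (X.homology n) := by
  refine ⟨fun h J f hJ ↦ ?_, fun h J hJ ↦ ?_⟩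
  · have : Injective J := hInj J hJ
    exact (isZero_homComplex_homology_iff X J n).1 (h J hJ) f
  · have : Injective J := hInj J hJ
    exact (isZero_homComplex_homology_iff X J n).2 fun f ↦ h f hJ

universe v' u'

variable {D : Type u'} [Category.{v'} D] [Abelian D] (L : A ⥤ D) [L.Additive]
  [(torsionClass I).IsSerreClass] [L.IsLocalization (torsionClass I).isoModSerre]

lemma preservesHomology_of_isLocalization (T : ObjectProperty A) [T.IsSerreClass]
    [L.IsLocalization T.isoModSerre] : L.PreservesHomology := by
  have := ObjectProperty.SerreClassLocalization.preservesFiniteLimits L T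
  have := ObjectProperty.SerreClassLocalization.preservesFiniteColimits L T
  infer_instance

/-- Both sides say that each `H^n(φ)` is inverted by every `Hom(-, J)`. -/
lemma quasiIso_map_iff_quasiIso_homComplexMap (hInj : I ≤ isInjective A)
    {X Y : CochainComplex A ℕ} (φ : X ⟶ Y) :
    QuasiIso ((L.mapHomologicalComplex _).map φ) ↔
      ∀ ⦃J : A⦄, I J → QuasiIso (homComplexMap φ J) := by
  have := preservesHomology_of_isLocalization L (torsionClass I)
  simp only [quasiIso_map_iff,
    ObjectProperty.SerreClassLocalization.isIso_map_iff L (torsionClass I),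
    isoModSerre_torsionClass hInj]
  refine ⟨fun h J hJ ↦ ?_, fun h n J hJ ↦ ?_⟩
  · have : Injective J := hInj J hJ
    exact (quasiIso_homComplexMap_iff φ J).2 fun n ↦ h n J hJ
  · have : Injective J := hInj J hJ
    exact (quasiIso_homComplexMap_iff φ J).1 (h hJ) n

end HomComplex

/-! ### Resolutions of families -/

section Families

variable {C : Type u} [Category.{v} C] [Abelian C] {Λ : Type w}

/-- A family of complexes, as a complex of families. -/
@[simps]
def familyComplex (K : Λ → CochainComplex C ℕ) : CochainComplex (Discrete Λ ⥤ C) ℕ where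
  X n := Discrete.functor fun l ↦ (K l).X n
  d i j := Discrete.natTrans fun l ↦ (K l.as).d i j

/-- The coaugmentation of a complex of families given by a family of coaugmentations. -/
noncomputable def familyCoaugmentation {X : Λ → C} {K : Λ → CochainComplex C ℕ}
    (u : ∀ l, (CochainComplex.single₀ C).obj (X l) ⟶ K l) :
    (CochainComplex.single₀ _).obj (Discrete.functor X) ⟶ familyComplex K :=
  (CochainComplex.fromSingle₀Equiv _ _).symm
    ⟨Discrete.natTrans fun l ↦ (u l.as).f 0, by
      ext ⟨l⟩
      exact ((CochainComplex.fromSingle₀Equiv _ _) (u l)).2⟩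

lemma quasiIso_familyCoaugmentation {X : Λ → C} {K : Λ → CochainComplex C ℕ}
    (u : ∀ l, (CochainComplex.single₀ C).obj (X l) ⟶ K l) [∀ l, QuasiIso (u l)] :
    QuasiIso (familyCoaugmentation u) := by
  rw [quasiIso_iff]
  intro n
  rw [quasiIsoAt_iff_isIso_homologyMap, NatTrans.isIso_iff_isIso_app]
  rintro ⟨l⟩
  let ev := (evaluation (Discrete Λ) C).obj ⟨l⟩
  let e : (ev.mapHomologicalComplex _).obj ((CochainComplex.single₀ _).obj (Discrete.functor X)) ≅
      (CochainComplex.single₀ C).obj (X l) :=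
    (HomologicalComplex.singleMapHomologicalComplex ev (ComplexShape.up ℕ) 0).app _
  let φ : (ev.mapHomologicalComplex _).obj
      ((CochainComplex.single₀ _).obj (Discrete.functor X)) ⟶ K l :=
    (ev.mapHomologicalComplex _).map (familyCoaugmentation u)
  have h : e.inv ≫ φ = u l := by
    apply HomologicalComplex.from_single_hom_ext
    have h₁ : e.inv.f 0 = 𝟙 (X l) :=
      (HomologicalComplex.singleMapHomologicalComplex_inv_app_self ev (ComplexShape.up ℕ) 0
        (Discrete.functor X)).trans (Category.id_comp _)
    have h₂ : φ.f 0 = (u l).f 0 := congr_app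
      (CochainComplex.fromSingle₀Equiv_symm_apply_f_zero (C := familyComplex K) _ _) ⟨l⟩
    rw [HomologicalComplex.comp_f, h₁, h₂]
    exact Category.id_comp _
  have : QuasiIso φ := by
    rw [← quasiIso_iff_comp_left e.inv, h]
    infer_instance
  exact (quasiIso_map_iff ev _).1 this n

/-- Injective resolutions of the members of a family give one of the family. -/
noncomputable def familyResolution {X : Λ → C} (K : Λ → CochainComplex C ℕ)
    (u : ∀ l, (CochainComplex.single₀ C).obj (X l) ⟶ K l) [∀ l, QuasiIso (u l)]
    (hK : ∀ l n, Injective ((K l).X n)) : InjectiveResolution (Discrete.functor X) where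
  cocomplex := familyComplex K
  injective n :=
    { factors {P Q} g f _ := ⟨Discrete.natTrans fun l ↦
          have := hK l.as n
          Injective.factorThru (J := (K l.as).X n) (g.app l) (f.app l), by
        ext l
        have := hK l.as n
        exact Injective.comp_factorThru (J := (K l.as).X n) _ _⟩ }
  ι := familyCoaugmentation u
  quasiIso := quasiIso_familyCoaugmentation u

end Families

/-! ### Derived products in the quotient -/

section DerivedProduct

universe v' u'

variable {A : Type u} [Category.{v} A] [Abelian A] {D : Type u'} [Category.{v'} D] [Abelian D]
  (L : A ⥤ D) [L.Additive] {Λ : Type w} [HasLimitsOfShape (Discrete Λ) A]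
  [HasLimitsOfShape (Discrete Λ) D]

/-- Products of complexes are degreewise, and locality of the terms lets `L` commute with them. -/
lemma nonempty_map_piObj_iso (W : MorphismProperty A) [L.IsLocalization W]
    [W.HasRightCalculusOfFractions] (K : Λ → CochainComplex A ℕ)
    (hK : ∀ l n, W.isLocal ((K l).X n)) :
    Nonempty ((L.mapHomologicalComplex _).obj (∏ᶜ K) ≅
      ((lim : (Discrete Λ ⥤ D) ⥤ D).mapHomologicalComplex _).obj
        (familyComplex fun l ↦ (L.mapHomologicalComplex _).obj (K l))) := by
  have h (n : ℕ) : Nonempty (IsLimit (Fan.mk (L.obj ((∏ᶜ K).X n))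
      fun l ↦ L.map ((Pi.π K l).f n))) :=
    nonempty_isLimit_map_fan L W (fun l ↦ hK l n)
      (isLimitFanMkObjOfIsLimit (HomologicalComplex.eval A (ComplexShape.up ℕ) n) K
        (fun l ↦ Pi.π K l) (productIsProduct K))
  let e (n : ℕ) : L.obj ((∏ᶜ K).X n) ≅ lim.obj (Discrete.functor fun l ↦ L.obj ((K l).X n)) :=
    (h n).some.conePointUniqueUpToIso (limit.isLimit _)
  have he (n : ℕ) (l : Λ) :
      (e n).hom ≫ limit.π (Discrete.functor fun l ↦ L.obj ((K l).X n)) ⟨l⟩ =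
        L.map ((Pi.π K l).f n) :=
    (h n).some.conePointUniqueUpToIso_hom_comp (limit.isLimit _) ⟨l⟩
  refine ⟨HomologicalComplex.Hom.isoOfComponents e fun i j _ ↦ ?_⟩
  apply limit.hom_ext
  rintro ⟨l⟩
  let δ : (Discrete.functor fun l ↦ L.obj ((K l).X i)) ⟶
      Discrete.functor fun l ↦ L.obj ((K l).X j) :=
    Discrete.natTrans fun l ↦ L.map ((K l.as).d i j)
  have h₁ : limMap δ ≫
      limit.π (Discrete.functor fun l ↦ L.obj ((K l).X j)) ⟨l⟩ =
      limit.π (Discrete.functor fun l ↦ L.obj ((K l).X i)) ⟨l⟩ ≫ L.map ((K l).d i j) :=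
    limMap_π _ _
  have h₂ : (e i).hom ≫
      limMap δ ≫
      limit.π (Discrete.functor fun l ↦ L.obj ((K l).X j)) ⟨l⟩ =
      L.map ((∏ᶜ K).d i j) ≫ (e j).hom ≫
        limit.π (Discrete.functor fun l ↦ L.obj ((K l).X j)) ⟨l⟩ := by
    rw [h₁, reassoc_of% (he i l), he j l, ← L.map_comp, ← L.map_comp,
      HomologicalComplex.Hom.comm]
  exact (Category.assoc _ _ _).trans (h₂.trans (Category.assoc _ _ _).symm)

variable {I : ObjectProperty A} [(torsionClass I).IsSerreClass]
  [L.IsLocalization (torsionClass I).isoModSerre] [EnoughInjectives D]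

/-- Derived products in a quotient category can be computed by products of complexes of
objects of `I`. -/
lemma isZero_derivedProduct_iff (hInj : I ≤ isInjective A) {B : Λ → D}
    (K : Λ → CochainComplex A ℕ) (hK : ∀ l n, I ((K l).X n))
    (u : ∀ l, (CochainComplex.single₀ D).obj (B l) ⟶ (L.mapHomologicalComplex _).obj (K l))
    [∀ l, QuasiIso (u l)] (n : ℕ) :
    IsZero (derivedProduct n B) ↔ torsionClass I ((∏ᶜ K).homology n) := by
  have := preservesHomology_of_isLocalization L (torsionClass I)
  obtain ⟨e⟩ := nonempty_map_piObj_iso L (torsionClass I).isoModSerre K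
    fun l n ↦ isLocal_isoModSerre_of_mem hInj (hK l n)
  let res : InjectiveResolution (Discrete.functor B) :=
    familyResolution _ u fun l n ↦ injective_obj_of_mem (L := L) hInj (hK l n)
  rw [← ObjectProperty.SerreClassLocalization.isZero_obj_iff L (torsionClass I)]
  refine Iso.isZero_iff ?_
  exact res.isoRightDerivedObj lim n ≪≫
    (HomologicalComplex.homologyFunctor D _ n).mapIso e.symm ≪≫ homologyMapIso L _ n

variable {L} in
/-- Injective resolutions in a quotient category come from relative injective resolutions. -/
lemma exists_relInjResolution {R : D ⥤ A} (hI : IsInjectiveClass.{w} I)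
    (hInj : I ≤ isInjective A) (adj : L ⊣ R) (B : D) :
    ∃ (K : RelInjResolution I (R.obj B))
      (u : (CochainComplex.single₀ D).obj B ⟶ (L.mapHomologicalComplex _).obj K.cocomplex),
      QuasiIso u := by
  have (Y : D) :=
    isIso_counit_app_of_isLocalization (torsionClass I).isoModSerre adj Y
  have : IsIso adj.counit := NatIso.isIso_of_isIso_app _
  have : R.Additive := adj.right_adjoint_additive
  let E := injectiveResolution B
  let c : ∀ K : CochainComplex D ℕ, (L.mapHomologicalComplex _).obj
      ((R.mapHomologicalComplex _).obj K) ≅ K := fun K ↦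
    (NatIso.mapHomologicalComplex (asIso adj.counit) (ComplexShape.up ℕ)).app K
  let s : (CochainComplex.single₀ A).obj (R.obj B) ≅
      (R.mapHomologicalComplex _).obj ((CochainComplex.single₀ D).obj B) :=
    ((HomologicalComplex.singleMapHomologicalComplex R (ComplexShape.up ℕ) 0).app B).symm
  have hE : (L.mapHomologicalComplex _).map ((R.mapHomologicalComplex _).map E.ι) ≫
      (c E.cocomplex).hom = (c _).hom ≫ E.ι :=
    (NatTrans.mapHomologicalComplex adj.counit (ComplexShape.up ℕ)).naturality E.ι
  refine ⟨{ cocomplex := (R.mapHomologicalComplex _).obj E.cocomplex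
            u := s.hom ≫ (R.mapHomologicalComplex _).map E.ι
            mem n := mem_of_injective_of_adj hI hInj adj (E.cocomplex.X n)
            quasiIso := ?_ }, E.ι ≫ (c E.cocomplex).inv, inferInstance⟩
  -- Through the counit isomorphism `L R ≅ 𝟭`, applying `L` to the coaugmentation recovers the
  -- quasi-isomorphism `E.ι`.
  rw [← quasiIso_map_iff_quasiIso_homComplexMap L hInj, Functor.map_comp,
    quasiIso_iff_comp_left, ← quasiIso_iff_comp_right _ (c E.cocomplex).hom, hE]
  infer_instance

end DerivedProduct

/-- The comparison of `(Ab.4*)-I-k` with `(Ab.4*)-k` for a localization at `⊥I`. -/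
theorem relAB4Star_iff_of_isLocalization {A : Type u} [Category.{v} A] [Abelian A]
    [HasLimitsOfSize.{w, w} A] {I : ObjectProperty A} (hI : IsInjectiveClass.{w} I)
    (hInj : I ≤ isInjective A) [(torsionClass I).IsSerreClass] {D : Type*} [Category* D]
    [Abelian D] (L : A ⥤ D) [L.Additive] [L.IsLocalization (torsionClass I).isoModSerre] (k : ℕ) :
    RelAB4Star.{w} I k ↔ RoosAB4Star.{w} D k := by
  have := isLeftAdjoint_of_exists_isLocal L (torsionClass I).isoModSerre
    (exists_isoModSerre_isLocal hI hInj)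
  let adj := Adjunction.ofIsLeftAdjoint L
  have hD : HasLimitsOfSize.{w, w} D :=
    hasLimitsOfSize_of_isLocalization (torsionClass I).isoModSerre adj
  have hD' := enoughInjectives_of_adj I hI hInj adj
  refine ⟨fun h ↦ ⟨hD, hD', fun Λ B n hn ↦ ?_⟩, fun h Λ X K J hJ n hn ↦ ?_⟩
  · choose K u hu using fun l ↦ exists_relInjResolution hI hInj adj (B l)
    rw [isZero_derivedProduct_iff L hInj (fun l ↦ (K l).cocomplex) (fun l ↦ (K l).mem) u,
      ← isZero_homComplex_homology_iff_torsionClass hInj]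
    exact fun J hJ ↦ h Λ _ K J hJ n hn
  -- The given resolutions of `X l` become injective resolutions of `L (X l)`, the family to which
  -- Roos's condition applies.
  · let u (l : Λ) : (CochainComplex.single₀ D).obj (L.obj (X l)) ⟶
        (L.mapHomologicalComplex _).obj (K l).cocomplex :=
      ((HomologicalComplex.singleMapHomologicalComplex L (ComplexShape.up ℕ) 0).app (X l)).inv ≫
        (L.mapHomologicalComplex _).map (K l).u
    have (l : Λ) : QuasiIso (u l) := by
      have := (quasiIso_map_iff_quasiIso_homComplexMap L hInj (K l).u).2 (K l).quasiIso
      exact quasiIso_comp _ _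
    exact (isZero_homComplex_homology_iff_torsionClass hInj _ n).2
      ((isZero_derivedProduct_iff L hInj (fun l ↦ (K l).cocomplex) (fun l ↦ (K l).mem) u n).1
        (h.isZero_derivedProduct Λ _ n hn)) J hJ

end RelInj

theorem mainTheorem7 {G : Type u} [Category.{v} G] [Abelian G] [IsGrothendieckAbelian.{w} G]
    (I : ObjectProperty G) (hI : RelInj.IsInjectiveClass.{w} I) (hInj : I ≤ isInjective G)
    (k : ℕ) :
    haveI := RelInj.isSerreClass_torsionClass hInj
    RelInj.RelAB4Star.{w} I k ↔
      RelInj.RoosAB4Star.{w} (RelInj.GabrielQuotient (RelInj.torsionClass I)) k := by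
  have := RelInj.isSerreClass_torsionClass hInj
  exact RelInj.relAB4Star_iff_of_isLocalization hI hInj
    (RelInj.quotientFunctor (RelInj.torsionClass I)) k
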